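/- A group $G$ is called a Howson group if for any two finitely generated subgroups $H, K \le G$ the intersection $H \cap K$ is again finitely generated. For every integer $n \ge 0$, let $F_n$ denote the free group of rank $n$. Then both groups $$F_n \times \bigoplus_{m=2}^{\infty} \mathbb{Z}/m\mathbb{Z} \qquad\text{and}\qquad F_n \times (\mathbb{Q}/\mathbb{Z})$$ are Howson groups. -/

import Mathlib

/-- A group is a Howson group if the intersection of any two finitely generated subgroups is
again finitely generated. -/
def IsHowson (G : Type*) [Group G] : Prop :=
  ∀ H K : Subgroup G, H.FG → K.FG → (H ⊓ K).FG

/-!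
Free groups of finite rank are Howson by the Stallings picture of subgroups. Call a subgroup
`H` of a free group *quasiconvex* (`FreeGroup.IsQuasiconvex`) if the prefixes of the reduced words of
its elements meet only finitely many cosets `H p`, that is, if its core graph is finite.

* A finitely generated subgroup is quasiconvex (`FreeGroup.isQuasiconvex_of_fg`): the property is
  clear for suitable unreduced spellings, namely products of generators, and reducing a word only
  removes group elements from the path that the word traces.
* Quasiconvexity passes to intersections (`FreeGroup.IsQuasiconvex.inf`), because the coset
  `(H ⊓ K) p` is determined by the pair `(H p, K p)`.
* A quasiconvex subgroup of a free group of finite rank is finitely generated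
  (`FreeGroup.IsQuasiconvex.fg`): reading off the reduced word of an element letter by letter writes
  it as a product of Schreier generators, of which only finitely many occur.

If `A` is a group whose finitely generated subgroups are finite, then `G × A` is Howson whenever `G`
is (`IsHowson.prod`): a finitely generated subgroup of `G × A` has finite image in `A`, so it meets
`G` in a subgroup of finite index, and the question reduces to intersections in `G`. This applies to
every abelian torsion group `A`, in particular to `⨁ ℤ/mℤ` and to `ℚ/ℤ`.
-/

open Pointwise

theorem List.prefix_append_cases {β : Type*} {p l₁ l₂ : List β} (h : p <+: l₁ ++ l₂) :
    p <+: l₁ ∨ ∃ q, p = l₁ ++ q ∧ q <+: l₂ := by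
  rcases List.prefix_or_prefix_of_prefix h (List.prefix_append l₁ l₂) with h' | ⟨q, rfl⟩
  · exact Or.inl h'
  · exact Or.inr ⟨q, rfl, (List.prefix_append_right_inj l₁).1 h⟩

/-! ### Quasiconvex subgroups of free groups -/

namespace FreeGroup

variable {α : Type*}

/-- One reduction step does not enlarge the set of group elements visited by a word. -/
theorem Red.Step.exists_prefix {L₁ L₂ : List (α × Bool)} (h : Red.Step L₁ L₂)
    {p : List (α × Bool)} (hp : p <+: L₂) : ∃ q, q <+: L₁ ∧ mk q = mk p := by
  obtain @⟨A, B, x, b⟩ := h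
  rcases List.prefix_append_cases hp with hp | ⟨q, rfl, hq⟩
  · exact ⟨p, hp.trans (List.prefix_append _ _), rfl⟩
  · refine ⟨A ++ (x, b) :: (x, !b) :: q, ?_, Quot.sound Red.Step.not⟩
    simpa using hq

theorem Red.exists_prefix {L₁ L₂ : List (α × Bool)} (h : Red L₁ L₂) :
    ∀ {p : List (α × Bool)}, p <+: L₂ → ∃ q, q <+: L₁ ∧ mk q = mk p := by
  induction h with
  | refl => exact fun {p} hp => ⟨p, hp, rfl⟩
  | tail _ hs ih =>
    intro p hp
    obtain ⟨q, hq, hqp⟩ := hs.exists_prefix hp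
    obtain ⟨r, hr, hrq⟩ := ih hq
    exact ⟨r, hr, hrq.trans hqp⟩

variable [DecidableEq α]

/-- A subgroup `H` of a free group is quasiconvex if finitely many cosets `H t` contain all prefixes
of the reduced words of elements of `H`. Membership of `g` in the coset `H t` is expressed as
`g * t⁻¹ ∈ H`. -/
def IsQuasiconvex (H : Subgroup (FreeGroup α)) : Prop :=
  ∃ T : Set (FreeGroup α), T.Finite ∧
    ∀ h ∈ H, ∀ p, p <+: h.toWord → ∃ t ∈ T, mk p * t⁻¹ ∈ H

theorem isQuasiconvex_of_fg {H : Subgroup (FreeGroup α)} (hH : H.FG) : IsQuasiconvex H := by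
  obtain ⟨S, hS⟩ := (Subgroup.fg_iff_submonoid_fg H).1 hH
  have hSH : ∀ x, x ∈ Submonoid.closure (S : Set (FreeGroup α)) ↔ x ∈ H := fun x => by
    rw [hS, Subgroup.mem_toSubmonoid]
  let T : Set (FreeGroup α) := insert 1 (⋃ s ∈ S, mk '' {p | p ∈ s.toWord.inits})
  refine ⟨T, (S.finite_toSet.biUnion fun s _ => (List.finite_toSet _).image _).insert 1, ?_⟩
  -- Some spelling of `h`, not necessarily reduced, stays inside the cosets of `T`.
  have key : ∀ h ∈ Submonoid.closure (S : Set (FreeGroup α)),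
      ∃ w, mk w = h ∧ ∀ p, p <+: w → ∃ t ∈ T, mk p * t⁻¹ ∈ H := by
    intro h hh
    induction hh using Submonoid.closure_induction with
    | mem s hs =>
      refine ⟨s.toWord, mk_toWord, fun p hp => ⟨mk p, Or.inr ?_, ?_⟩⟩
      · exact Set.mem_biUnion hs ⟨p, (List.mem_inits _ _).2 hp, rfl⟩
      · rw [mul_inv_cancel]
        exact H.one_mem
    | one =>
      refine ⟨[], rfl, fun p hp => ⟨1, Or.inl rfl, ?_⟩⟩
      rw [List.prefix_nil.1 hp]
      simp [← one_eq_mk]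
    | mul x y hx hy ihx ihy =>
      obtain ⟨v, rfl, hv⟩ := ihx
      obtain ⟨w, rfl, hw⟩ := ihy
      refine ⟨v ++ w, mul_mk.symm, fun p hp => ?_⟩
      rcases List.prefix_append_cases hp with hp | ⟨q, rfl, hq⟩
      · exact hv p hp
      · obtain ⟨t, ht, htH⟩ := hw q hq
        refine ⟨t, ht, ?_⟩
        rw [← mul_mk, mul_assoc]
        exact H.mul_mem ((hSH _).1 hx) htH
  intro h hh p hp
  obtain ⟨w, rfl, hw⟩ := key h ((hSH h).2 hh)
  rw [toWord_mk] at hp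
  obtain ⟨q, hq, hqp⟩ := Red.exists_prefix reduce.red hp
  exact hqp ▸ hw q hq

theorem IsQuasiconvex.inf {H K : Subgroup (FreeGroup α)} (hH : IsQuasiconvex H)
    (hK : IsQuasiconvex K) : IsQuasiconvex (H ⊓ K) := by
  classical
  obtain ⟨T, hT, hTH⟩ := hH
  obtain ⟨U, hU, hUK⟩ := hK
  -- A common representative of the cosets `H t` and `K u`, if they meet.
  let f : FreeGroup α × FreeGroup α → FreeGroup α := fun x =>
    if hx : ∃ w, w * x.1⁻¹ ∈ H ∧ w * x.2⁻¹ ∈ K then hx.choose else 1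
  refine ⟨f '' (T ×ˢ U), (hT.prod hU).image f, fun h hh p hp => ?_⟩
  obtain ⟨t, ht, htH⟩ := hTH h hh.1 p hp
  obtain ⟨u, hu, huK⟩ := hUK h hh.2 p hp
  have hx : ∃ w, w * (t, u).1⁻¹ ∈ H ∧ w * (t, u).2⁻¹ ∈ K := ⟨mk p, htH, huK⟩
  refine ⟨f (t, u), ⟨(t, u), ⟨ht, hu⟩, rfl⟩, ?_⟩
  have hf : f (t, u) = hx.choose := dif_pos hx
  obtain ⟨h₁, h₂⟩ := hx.choose_spec
  rw [← hf] at h₁ h₂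
  constructor
  · simpa using H.mul_mem htH (H.inv_mem h₁)
  · simpa using K.mul_mem huK (K.inv_mem h₂)

theorem IsQuasiconvex.fg [Finite α] {H : Subgroup (FreeGroup α)} (hH : IsQuasiconvex H) :
    H.FG := by
  obtain ⟨T, hT, hTH⟩ := hH
  let T' : Set (FreeGroup α) := insert 1 T
  have hT' : T'.Finite := hT.insert 1
  let A : Set (FreeGroup α) := Set.range fun a : α × Bool => mk [a]
  -- The Schreier generators `t * a * t'⁻¹`; representatives lying in `H` itself are added so that
  -- the coset `H` may be represented by any of them.
  let U : Set (FreeGroup α) := {u | u ∈ T' ∪ T' * A * T'⁻¹ ∧ u ∈ H}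
  have hU : U.Finite :=
    (hT'.union ((hT'.mul (Set.finite_range _)).mul hT'.inv)).subset fun u hu => hu.1
  have hUH : Subgroup.closure U ≤ H := (Subgroup.closure_le H).2 fun u hu => hu.2
  refine (Subgroup.fg_iff H).2 ⟨U, le_antisymm hUH fun h hh => ?_, hU⟩
  have key : ∀ p, p <+: h.toWord → ∀ t' ∈ T', mk p * t'⁻¹ ∈ H →
      mk p * t'⁻¹ ∈ Subgroup.closure U := by
    intro p
    induction p using List.reverseRecOn with
    | nil =>
      intro _ t' ht' hm
      rw [← one_eq_mk, one_mul, inv_mem_iff] at hm ⊢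
      exact Subgroup.subset_closure ⟨Or.inl ht', hm⟩
    | append_singleton p a ih =>
      intro hp t' ht' hm
      have hp' : p <+: h.toWord := (List.prefix_append p [a]).trans hp
      obtain ⟨t, ht, htH⟩ := hTH h hh p hp'
      have e : mk (p ++ [a]) * t'⁻¹ = mk p * t⁻¹ * (t * mk [a] * t'⁻¹) := by
        rw [← mul_mk]; group
      rw [e] at hm ⊢
      refine mul_mem (ih hp' t (Or.inr ht) htH) (Subgroup.subset_closure ⟨Or.inr ?_, ?_⟩)
      · exact Set.mul_mem_mul (Set.mul_mem_mul (Or.inr ht) ⟨a, rfl⟩) (Set.inv_mem_inv.2 ht')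
      · exact (H.mul_mem_cancel_left htH).1 hm
  simpa [mk_toWord] using key h.toWord List.prefix_rfl 1 (Or.inl rfl) (by simpa [mk_toWord] using hh)

/-- **Howson's theorem** for free groups of finite rank. -/
theorem isHowson [Finite α] : IsHowson (FreeGroup α) := fun _ _ hH hK =>
  ((isQuasiconvex_of_fg hH).inf (isQuasiconvex_of_fg hK)).fg

end FreeGroup

/-! ### Products with locally finite groups -/

theorem Subgroup.FG.map {G G' : Type*} [Group G] [Group G'] {H : Subgroup G} (hH : H.FG)
    (f : G →* G') : (H.map f).FG := by
  classical
  obtain ⟨S, rfl⟩ := hH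
  exact ⟨S.image f, by rw [Finset.coe_image, MonoidHom.map_closure]⟩

section Prod

variable {G A : Type*} [Group G] [Group A]

/-- The intersection of `L` with the first factor has finite index in `L`, so Schreier's lemma
applies. -/
theorem Subgroup.FG.comap_inl {L : Subgroup (G × A)} (hL : L.FG)
    (hfin : Finite (L.map (MonoidHom.snd G A))) : (L.comap (MonoidHom.inl G A)).FG := by
  let f : L →* A := (MonoidHom.snd G A).comp L.subtype
  have hf : f.range = L.map (MonoidHom.snd G A) := by
    rw [MonoidHom.range_comp, Subgroup.range_subtype]
  have : Finite f.range := hf ▸ hfin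
  have : Group.FG L := (Group.fg_iff_subgroup_fg L).2 hL
  have : f.ker.FiniteIndex := inferInstance
  have hker : f.ker.FG := (Group.fg_iff_subgroup_fg _).1 (Subgroup.fg_of_index_ne_zero f.ker)
  have e : L.comap (MonoidHom.inl G A) = f.ker.map ((MonoidHom.fst G A).comp L.subtype) := by
    ext g
    constructor
    · exact fun hg => ⟨⟨(g, 1), hg⟩, rfl, rfl⟩
    · rintro ⟨⟨⟨g', a⟩, hL'⟩, ha, rfl⟩
      obtain rfl : a = 1 := ha
      exact hL'
  rw [e]
  exact hker.map _

/-- `L` is generated by its intersection with the first factor and by one preimage for each of the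
finitely many elements of its projection to the second factor. -/
theorem Subgroup.fg_of_fg_comap_inl {L : Subgroup (G × A)}
    (hL : (L.comap (MonoidHom.inl G A)).FG) (hfin : Finite (L.map (MonoidHom.snd G A))) :
    L.FG := by
  choose s hsL hs using fun a : L.map (MonoidHom.snd G A) => Subgroup.mem_map.1 a.2
  have h : L = (L.comap (MonoidHom.inl G A)).map (MonoidHom.inl G A) ⊔
      Subgroup.closure (Set.range s) := by
    apply le_antisymm
    · intro x hx
      let a : L.map (MonoidHom.snd G A) := ⟨x.2, x, hx, rfl⟩
      have ha : (s a).2 = x.2 := hs a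
      have hm : (MonoidHom.inl G A) (x.1 * (s a).1⁻¹) = x * (s a)⁻¹ := by
        ext <;> simp [ha]
      rw [← inv_mul_cancel_right x (s a), ← hm]
      refine Subgroup.mul_mem_sup (Subgroup.mem_map_of_mem _ ?_)
        (Subgroup.subset_closure ⟨a, rfl⟩)
      rw [Subgroup.mem_comap, hm]
      exact L.mul_mem hx (L.inv_mem (hsL a))
    · refine sup_le (Subgroup.map_comap_le _ _) ((Subgroup.closure_le L).2 ?_)
      rintro _ ⟨a, rfl⟩
      exact hsL a
  rw [h]
  exact (hL.map _).sup ((Subgroup.fg_iff _).2 ⟨_, rfl, Set.finite_range s⟩)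

theorem IsHowson.prod (hG : IsHowson G) (hA : ∀ B : Subgroup A, B.FG → Finite B) :
    IsHowson (G × A) := by
  intro H K hH hK
  have hHfin := hA _ (hH.map (MonoidHom.snd G A))
  have hKfin := hA _ (hK.map (MonoidHom.snd G A))
  apply Subgroup.fg_of_fg_comap_inl
  · rw [Subgroup.comap_inf]
    exact hG _ _ (hH.comap_inl hHfin) (hK.comap_inl hKfin)
  · exact Finite.of_injective _
      (Subgroup.inclusion_injective (Subgroup.map_mono (f := MonoidHom.snd G A) inf_le_left))

end Prod

/-! ### Torsion coefficients -/

theorem finite_subgroup_of_fg_of_torsion {A : Type*} [AddCommGroup A]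
    (hA : ∀ a : A, IsOfFinAddOrder a) (B : Subgroup (Multiplicative A)) (hB : B.FG) : Finite B := by
  have : Group.FG B := (Group.fg_iff_subgroup_fg B).2 hB
  refine CommGroup.finite_of_fg_isMulTorsion B fun b => ?_
  have hb : IsOfFinOrder (b : Multiplicative A) :=
    isOfFinOrder_ofAdd_iff (α := A).2 (hA (b : Multiplicative A).toAdd)
  exact Submonoid.isOfFinOrder_coe (H := B.toSubmonoid).1 hb

theorem isOfFinAddOrder_directSum_zmod
    (x : DirectSum {m : ℕ // 2 ≤ m} (fun m => ZMod (m : ℕ))) : IsOfFinAddOrder x := by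
  induction x using DirectSum.induction_on with
  | zero => exact IsOfFinAddOrder.zero
  | of m a =>
    have : NeZero (m : ℕ) := ⟨by have := m.2; omega⟩
    exact AddMonoidHom.isOfFinAddOrder _ (isOfFinAddOrder_of_finite a)
  | add x y hx hy => exact hx.add hy

theorem isOfFinAddOrder_rat_quotient_int (x : ℚ ⧸ (Int.castAddHom ℚ).range) :
    IsOfFinAddOrder x := by
  obtain ⟨q, rfl⟩ := QuotientAddGroup.mk_surjective x
  refine isOfFinAddOrder_iff_nsmul_eq_zero.2 ⟨q.den, q.den_pos, ?_⟩
  rw [← QuotientAddGroup.mk_nsmul, QuotientAddGroup.eq_zero_iff]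
  exact ⟨q.num, by simp [Rat.den_mul_eq_num]⟩

theorem mainTheorem2 (n : ℕ) :
    IsHowson (FreeGroup (Fin n) ×
      Multiplicative (DirectSum {m : ℕ // 2 ≤ m} (fun m => ZMod (m : ℕ)))) ∧
    IsHowson (FreeGroup (Fin n) ×
      Multiplicative (ℚ ⧸ (Int.castAddHom ℚ).range)) :=
  ⟨FreeGroup.isHowson.prod (finite_subgroup_of_fg_of_torsion isOfFinAddOrder_directSum_zmod),
    FreeGroup.isHowson.prod (finite_subgroup_of_fg_of_torsion isOfFinAddOrder_rat_quotient_int)⟩
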